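/- Let $n, r \ge 0$ be integers, let $K$ be a commutative integral domain, and let $V$ be a free $K$-module of rank $n$. Let the symmetric group $\mathfrak{S}_r$ act on $V^{\otimes r}$ by place permutations, $\sigma$ sending $u_1 \otimes \cdots \otimes u_r$ to the tensor whose factor in position $i$ is $u_{\sigma^{-1}(i)}$, and let $\Phi : K\mathfrak{S}_r \to \operatorname{End}_K(V^{\otimes r})$ be the resulting representation of the group algebra. Then the image $\Phi(K\mathfrak{S}_r)$ is a free $K$-module of finite rank $$ r! - \sum_{\lambda \in P} N(\lambda)^2 . $$ Here $P$ is the set of partitions $\lambda$ of $r$ whose first (largest) part satisfies $\lambda_1 > n$, and $N(\lambda)$ is the number of standard tableaux of shape $\lambda$, that is, of bijections from the boxes of the Young diagram of $\lambda$ to $\{1, \dots, r\}$ whose values increase from left to right along each row and from top to bottom along each column. In particular, the rank of $\Phi(K\mathfrak{S}_r)$ does not depend on $K$: if $K'$ is another commutative integral domain and $V'$ is a free $K'$-module of rank $n$, then the images of $K\mathfrak{S}_r$ in $\operatorname{End}_K(V^{\otimes r})$ and of $K'\mathfrak{S}_r$ in $\operatorname{End}_{K'}(V'^{\otimes r})$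 have the same rank. -/

import Mathlib

open scoped TensorProduct

/-- The Young diagram of a partition `μ` of `r`: left-justified rows of boxes whose lengths,
from top to bottom, are the parts of `μ` in weakly decreasing order. Boxes are pairs
`(row, column)`. -/
def Nat.Partition.youngDiagram {r : ℕ} (μ : Nat.Partition r) : YoungDiagram :=
  YoungDiagram.ofRowLens (μ.parts.sort (· ≥ ·)) (μ.parts.pairwise_sort (· ≥ ·)).sortedGE

/-- A numbering `T` of the boxes of a Young diagram by an `r`-element linearly ordered set
(each number used once) is standard if the entries increase from left to right along each row
and from top to bottom along each column. -/
def IsStandardTableau {D : YoungDiagram} {r : ℕ} (T : D.cells ≃ Fin r) : Prop :=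
  (∀ c d : D.cells, c.1.1 = d.1.1 → c.1.2 < d.1.2 → T c < T d) ∧
  (∀ c d : D.cells, c.1.2 = d.1.2 → c.1.1 < d.1.1 → T c < T d)

/-- `N(μ)`: the number of standard tableaux of shape `μ`. -/
noncomputable def numStandardTableaux {r : ℕ} (μ : Nat.Partition r) : ℕ :=
  Nat.card {T : μ.youngDiagram.cells ≃ Fin r // IsStandardTableau T}

/-- The set `P` of the partitions of `r` whose first (that is, largest) part exceeds `n`. -/
def partitionsWithLargeFirstPart (n r : ℕ) : Finset (Nat.Partition r) :=
  Finset.univ.filter fun μ => n < μ.parts.sup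

section PlacePermutation

variable (K : Type*) [CommRing K] (V : Type*) [AddCommGroup V] [Module K V] (r : ℕ)

/-- Place permutations on `V^{⊗r}`:
`σ` sends `u_1 ⊗ ⋯ ⊗ u_r` to the tensor whose factor in position `i` is `u_{σ⁻¹ i}`.
(A right action of the symmetric group with maps composed from left to right is the same thing
as a left action of `Equiv.Perm`, where maps are composed from right to left.) -/
noncomputable def placePermutation :
    Representation K (Equiv.Perm (Fin r)) (⨂[K]^r V) where
  toFun σ := (PiTensorProduct.reindex K (fun _ : Fin r => V) σ).toLinearMap
  map_one' := by
    ext u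
    simp
    rfl
  map_mul' σ τ := by
    ext u
    simp [Equiv.Perm.mul_def]
    rfl

theorem placePermutation_tprod (σ : Equiv.Perm (Fin r)) (u : Fin r → V) :
    placePermutation K V r σ (PiTensorProduct.tprod K u) =
      PiTensorProduct.tprod K fun i => u (σ⁻¹ i) := by
  simp [placePermutation, PiTensorProduct.reindex_tprod, Equiv.Perm.inv_def]

/-- The representation `Φ` of the group algebra of the symmetric group on `V^{⊗r}`. -/
noncomputable def groupAlgebraRep :
    MonoidAlgebra K (Equiv.Perm (Fin r)) →ₐ[K] Module.End K (⨂[K]^r V) :=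
  (placePermutation K V r).asAlgebraHom

end PlacePermutation

/-!
Let `n` be the rank of `V`. Both the freeness of the image and its rank come from an explicit basis,
valid over any nontrivial commutative ring: the images of the permutations `σ` without an increasing
subsequence of more than `n` terms (`groupAlgebraRepRangeBasis`).

* They span. The alternating sum over the permutations of `n + 1` given positions acts as zero
  (`sum_sign_smul_placePermutation_eq_zero`). If `σ` increases on these positions, multiplying this
  relation by `σ` expresses `σ` by permutations whose one-line notation is lexicographically larger.
* They are independent. If `σ` has no such subsequence, its positions can be coloured with `n`
  colours `f` so that `σ` decreases on each colour. The coefficient of `⨂ i, b (f (σ⁻¹ i))` in the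
  image of `⨂ i, b (f i)` under `τ` is nonzero only if `τ` is `σ` rearranged within the colours, and
  then `τ` is lexicographically at most `σ`. So the matrix of coefficients is unitriangular.

It remains to count the permutations with an increasing subsequence of more than `n` terms. By the
Robinson–Schensted correspondence these are in bijection with the pairs of standard tableaux of the
same shape whose first row has more than `n` boxes. The correspondence is set up by growth diagrams:
partitions, given by their row lengths, are placed at the points of an `r × r` grid, subject to a
local rule in each unit square that involves the entry of the permutation matrix there. The
piecewise linear form of the rule (`IsGrowth`) is solvable both for the far corner and for the near
corner together with the entry, so a diagram is determined by the permutation, and equally by the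
two saturated chains of partitions on the far sides (`bijOn_schenstedChains`). The first row in the
local rule satisfies the recursion for the longest increasing subsequence
(`le_growth_permMatrix_zero_iff`).
Finally, saturated chains of partitions are the same thing as standard tableaux
(`TableauPair.bijOn_chains`).
-/

/-! ### Increasing subsequences and the lexicographic order -/

/-- `σ` has an increasing subsequence with more than `n` terms. A subsequence is encoded by its set
`s` of positions. -/
def HasIncreasingSubseq {r : ℕ} (n : ℕ) (σ : Equiv.Perm (Fin r)) : Prop :=
  ∃ s : Finset (Fin r), n < s.card ∧ StrictMonoOn σ s

/-- The one-line notation of a permutation, as an element of the lexicographically ordered set of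
words. -/
def oneLine {r : ℕ} (σ : Equiv.Perm (Fin r)) : Lex (Fin r → Fin r) := toLex σ

/-- The first point moved by a permutation is moved to the right. -/
theorem Equiv.Perm.exists_first_moved {r : ℕ} {w : Equiv.Perm (Fin r)} (hw : w ≠ 1) :
    ∃ a, (∀ x < a, w x = x) ∧ a < w a := by
  have hex : ∃ a, w a ≠ a := by
    by_contra! h
    exact hw (Equiv.ext h)
  obtain ⟨a, ha, hmin⟩ := WellFounded.has_min (wellFounded_lt (α := Fin r)) {a | w a ≠ a} hex
  have hfix : ∀ x < a, w x = x := fun x hx => by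
    by_contra h
    exact hmin x h hx
  refine ⟨a, hfix, lt_of_le_of_ne ?_ (Ne.symm ha)⟩
  by_contra! h
  exact ha (w.injective (hfix _ h))

/-- Rearranging the values of `σ` on a set of positions where it increases makes the one-line
notation lexicographically larger. -/
theorem oneLine_lt_mul {r : ℕ} {σ w : Equiv.Perm (Fin r)} {s : Finset (Fin r)}
    (hσ : StrictMonoOn σ s) (hws : ∀ x ∉ s, w x = x) (hw : w ≠ 1) :
    oneLine σ < oneLine (σ * w) := by
  obtain ⟨a, hfix, ha⟩ := w.exists_first_moved hw
  have has : a ∈ s := by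
    by_contra h
    exact ha.ne' (hws a h)
  have hwas : w a ∈ s := by
    by_contra h
    exact ha.ne' (w.injective (hws _ h))
  refine ⟨a, fun x hx => ?_, ?_⟩
  · change σ x = σ (w x)
    rw [hfix x hx]
  · exact hσ has hwas ha

/-- Rearranging the values of `σ` within colour classes on each of which it decreases makes the
one-line notation lexicographically smaller. -/
theorem oneLine_mul_lt {r : ℕ} {ι : Type*} {σ w : Equiv.Perm (Fin r)} {f : Fin r → ι}
    (hσ : ∀ i j, i < j → f i = f j → σ j < σ i) (hwf : ∀ i, f (w i) = f i) (hw : w ≠ 1) :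
    oneLine (σ * w) < oneLine σ := by
  obtain ⟨a, hfix, ha⟩ := w.exists_first_moved hw
  refine ⟨a, fun x hx => ?_, ?_⟩
  · change σ (w x) = σ x
    rw [hfix x hx]
  · exact hσ a (w a) ha (hwf a).symm

/-- A permutation without an increasing subsequence of more than `n` terms is a union of `n`
decreasing subsequences: colour a position by the length of the longest increasing subsequence
lying strictly before and below it. -/
theorem exists_coloring_of_not_hasIncreasingSubseq {n r : ℕ} {σ : Equiv.Perm (Fin r)}
    (h : ¬ HasIncreasingSubseq n σ) :
    ∃ f : Fin r → Fin n, ∀ i j, i < j → f i = f j → σ j < σ i := by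
  classical
  let S : Fin r → Finset (Finset (Fin r)) := fun i =>
    Finset.univ.filter fun s => StrictMonoOn σ s ∧ ∀ x ∈ s, x < i ∧ σ x < σ i
  let c : Fin r → ℕ := fun i => (S i).sup Finset.card
  have hne : ∀ i, (S i).Nonempty := fun i => ⟨∅, by simp [S, StrictMonoOn]⟩
  have hins : ∀ i, ∃ s : Finset (Fin r), s.card = c i + 1 ∧ StrictMonoOn σ s ∧
      ∀ x ∈ s, x ≤ i ∧ σ x ≤ σ i := by
    intro i
    obtain ⟨s, hs, hcard⟩ := Finset.exists_mem_eq_sup (S i) (hne i) Finset.card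
    simp only [S, Finset.mem_filter, Finset.mem_univ, true_and] at hs
    have his : i ∉ s := fun hi => lt_irrefl _ (hs.2 i hi).1
    refine ⟨insert i s, by rw [Finset.card_insert_of_notMem his]; exact congrArg (· + 1) hcard.symm,
      ?_, ?_⟩
    · intro x hx y hy hxy
      simp only [Finset.coe_insert, Set.mem_insert_iff, Finset.mem_coe] at hx hy
      rcases hx with rfl | hx
      · rcases hy with rfl | hy
        · exact absurd hxy (lt_irrefl _)
        · exact absurd hxy (hs.2 y hy).1.asymm
      · rcases hy with rfl | hy
        · exact (hs.2 x hx).2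
        · exact hs.1 hx hy hxy
    · intro x hx
      rcases Finset.mem_insert.1 hx with rfl | hx
      · exact ⟨le_rfl, le_rfl⟩
      · exact ⟨(hs.2 x hx).1.le, (hs.2 x hx).2.le⟩
  have hlt : ∀ i, c i < n := by
    intro i
    obtain ⟨s, hcard, hs, -⟩ := hins i
    by_contra! hn
    exact h ⟨s, by omega, hs⟩
  refine ⟨fun i => ⟨c i, hlt i⟩, fun i j hij hc => ?_⟩
  by_contra! hσ
  have hσ' : σ i < σ j := lt_of_le_of_ne hσ fun e => hij.ne (σ.injective e)
  obtain ⟨s, hcard, hs, hb⟩ := hins i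
  have hmem : s ∈ S j := by
    simp only [S, Finset.mem_filter, Finset.mem_univ, true_and]
    exact ⟨hs, fun x hx => ⟨(hb x hx).1.trans_lt hij, (hb x hx).2.trans_lt hσ'⟩⟩
  have h1 : s.card ≤ c j := Finset.le_sup (f := Finset.card) hmem
  have h2 : c i = c j := by simpa using hc
  omega

/-! ### A basis of the image of the group algebra -/

section Representation

variable {K : Type*} [CommRing K] {V : Type*} [AddCommGroup V] [Module K V] {n r : ℕ}

/-- Alternating over more positions than the rank of `V` kills `V^{⊗r}`: on a tensor of basis
vectors two of these positions carry the same vector, and composing with their transposition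
matches the terms in pairs that cancel. -/
theorem sum_sign_smul_placePermutation_eq_zero (b : Module.Basis (Fin n) K V)
    (s : Finset (Fin r)) (hs : n < s.card) :
    ∑ w : Equiv.Perm (Fin r) with ∀ x ∉ s, w x = x,
      ((Equiv.Perm.sign w : ℤ) : K) • placePermutation K V r w = 0 := by
  classical
  apply PiTensorProduct.ext
  apply Module.Basis.ext_multilinear (fun _ => b)
  intro f
  simp only [LinearMap.compMultilinearMap_apply, LinearMap.sum_apply, LinearMap.smul_apply,
    placePermutation_tprod, LinearMap.zero_apply]
  obtain ⟨x, hx, y, hy, hxy, hf⟩ :=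
    Finset.exists_ne_map_eq_of_card_lt_of_maps_to (s := s) (t := Finset.univ) (f := f)
      (by simpa using hs) (fun _ _ => Finset.mem_coe.2 (Finset.mem_univ _))
  refine Finset.sum_involution (fun w _ => w * Equiv.swap x y) ?_ ?_ ?_ ?_
  · intro w _
    have : ∀ i, f ((w * Equiv.swap x y)⁻¹ i) = f (w⁻¹ i) := by
      intro i
      rw [mul_inv_rev, Equiv.swap_inv, Equiv.Perm.mul_apply]
      by_cases h1 : w⁻¹ i = x
      · rw [h1, Equiv.swap_apply_left, hf]
      by_cases h2 : w⁻¹ i = y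
      · rw [h2, Equiv.swap_apply_right, hf]
      rw [Equiv.swap_apply_of_ne_of_ne h1 h2]
    simp only [this, map_mul, Equiv.Perm.sign_swap hxy]
    simp
  · intro w _ _ h
    exact hxy (Equiv.swap_eq_one_iff.1 (mul_eq_left.1 h))
  · intro w hw
    simp only [Finset.mem_filter, Finset.mem_univ, true_and] at hw ⊢
    intro z hz
    rw [Equiv.Perm.mul_apply, Equiv.swap_apply_of_ne_of_ne (ne_of_mem_of_not_mem hx hz).symm
      (ne_of_mem_of_not_mem hy hz).symm, hw z hz]
  · intro w _
    simp [mul_assoc]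

/-- Straightening: a permutation that increases on more than `n` positions is, on `V^{⊗r}`, a
combination of permutations with larger one-line notation. -/
theorem placePermutation_mem_span (b : Module.Basis (Fin n) K V) (σ : Equiv.Perm (Fin r)) :
    placePermutation K V r σ ∈ Submodule.span K
      (Set.range fun τ : {τ : Equiv.Perm (Fin r) // ¬ HasIncreasingSubseq n τ} =>
        placePermutation K V r τ) := by
  classical
  induction σ using (InvImage.wf oneLine (wellFounded_gt (α := Lex (Fin r → Fin r)))).induction with
  | _ σ ih =>
  by_cases h : HasIncreasingSubseq n σ
  · obtain ⟨s, hs, hmono⟩ := h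
    have key := congrArg (placePermutation K V r σ * ·)
      (sum_sign_smul_placePermutation_eq_zero b s hs)
    simp only [mul_zero, Finset.mul_sum, mul_smul_comm, ← map_mul] at key
    rw [← Finset.add_sum_erase _ _ (a := 1) (by simp)] at key
    simp only [mul_one, Equiv.Perm.sign_one, Units.val_one, Int.cast_one, one_smul] at key
    rw [eq_neg_of_add_eq_zero_left key]
    refine Submodule.neg_mem _ (Submodule.sum_mem _ fun w hw => Submodule.smul_mem _ _ (ih _ ?_))
    simp only [Finset.mem_erase, Finset.mem_filter, Finset.mem_univ, true_and] at hw
    exact oneLine_lt_mul hmono hw.2 hw.1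
  · exact Submodule.subset_span ⟨⟨σ, h⟩, rfl⟩

/-- The coordinate of a tensor at the basis tensor `⨂ i, b (g i)`. -/
noncomputable def tensorCoord (b : Module.Basis (Fin n) K V) (g : Fin r → Fin n) :
    (⨂[K]^r V) →ₗ[K] K :=
  PiTensorProduct.lift ((MultilinearMap.mkPiAlgebra K (Fin r) K).compLinearMap
    fun i => b.coord (g i))

theorem tensorCoord_tprod_basis (b : Module.Basis (Fin n) K V) (f g : Fin r → Fin n) :
    tensorCoord b g (PiTensorProduct.tprod K fun i => b (f i)) = if f = g then 1 else 0 := by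
  classical
  rw [tensorCoord, PiTensorProduct.lift.tprod]
  simp only [MultilinearMap.compLinearMap_apply, MultilinearMap.mkPiAlgebra_apply,
    Module.Basis.coord_apply, Module.Basis.repr_self, Finsupp.single_apply]
  split_ifs with h
  · exact Finset.prod_eq_one fun i _ => if_pos (congrFun h i)
  · obtain ⟨i, hi⟩ := Function.ne_iff.1 h
    exact Finset.prod_eq_zero (Finset.mem_univ i) (if_neg hi)

/-- Induction along the lexicographic order: for the colouring `f` attached to `σ`, the coefficient
of `⨂ i, b (f (σ⁻¹ i))` in the image of `⨂ i, b (f i)` involves `σ` and smaller permutations only. -/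
theorem linearIndependent_placePermutation (b : Module.Basis (Fin n) K V) :
    LinearIndependent K fun τ : {τ : Equiv.Perm (Fin r) // ¬ HasIncreasingSubseq n τ} =>
      placePermutation K V r τ := by
  classical
  rw [Fintype.linearIndependent_iff]
  intro a ha σ
  induction σ using
    (InvImage.wf (fun σ : {τ : Equiv.Perm (Fin r) // ¬ HasIncreasingSubseq n τ} => oneLine σ.1)
      (wellFounded_lt (α := Lex (Fin r → Fin r)))).induction with
  | _ σ ih =>
  obtain ⟨f, hf⟩ := exists_coloring_of_not_hasIncreasingSubseq σ.2
  have h := congrArg (fun φ : Module.End K (⨂[K]^r V) =>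
    tensorCoord b (fun i => f (σ.1⁻¹ i)) (φ (PiTensorProduct.tprod K fun i => b (f i)))) ha
  simp only [LinearMap.sum_apply, LinearMap.smul_apply, placePermutation_tprod, map_sum, map_smul,
    LinearMap.zero_apply, map_zero] at h
  rw [Finset.sum_eq_single σ] at h
  · rw [tensorCoord_tprod_basis b (fun i => f (σ.1⁻¹ i))] at h
    simpa using h
  · intro τ _ hτ
    rw [tensorCoord_tprod_basis b (fun i => f (τ.1⁻¹ i))]
    split_ifs with e
    · have hlt : oneLine (σ.1 * (σ.1⁻¹ * τ.1)) < oneLine σ.1 := by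
        refine oneLine_mul_lt hf (fun i => ?_) fun h1 => hτ ?_
        · simpa using (congrFun e (τ.1 i)).symm
        · exact Subtype.ext (inv_mul_eq_one.1 h1).symm
      rw [mul_inv_cancel_left] at hlt
      rw [ih τ hlt, zero_smul]
    · rw [smul_zero]
  · simp

theorem groupAlgebraRep_range_eq_span :
    Subalgebra.toSubmodule (groupAlgebraRep K V r).range =
      Submodule.span K (Set.range (placePermutation K V r)) := by
  refine le_antisymm ?_ (Submodule.span_le.2 ?_)
  · rintro _ ⟨x, rfl⟩
    change groupAlgebraRep K V r x ∈ _
    rw [groupAlgebraRep, Representation.asAlgebraHom_def, MonoidAlgebra.lift_apply]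
    exact Submodule.sum_mem _ fun σ _ =>
      Submodule.smul_mem _ _ (Submodule.subset_span ⟨σ, rfl⟩)
  · rintro _ ⟨σ, rfl⟩
    exact ⟨MonoidAlgebra.single σ 1, Representation.asAlgebraHom_single_one _ σ⟩

/-- The permutations without an increasing subsequence of more than `n` terms index a basis of the
image of the group algebra. -/
noncomputable def groupAlgebraRepRangeBasis (b : Module.Basis (Fin n) K V) :
    Module.Basis {τ : Equiv.Perm (Fin r) // ¬ HasIncreasingSubseq n τ} K
      (groupAlgebraRep K V r).range :=
  (Module.Basis.span (linearIndependent_placePermutation b)).map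
    (LinearEquiv.ofEq _ (Subalgebra.toSubmodule (groupAlgebraRep K V r).range) (by
      rw [groupAlgebraRep_range_eq_span]
      refine le_antisymm (Submodule.span_mono ?_) (Submodule.span_le.2 ?_)
      · rintro _ ⟨τ, rfl⟩
        exact ⟨τ.1, rfl⟩
      · rintro _ ⟨τ, rfl⟩
        exact placePermutation_mem_span b τ))

end Representation

/-! ### Growth diagrams -/

/-- `lam` and `mu` interlace: `mu 0 ≥ lam 0 ≥ mu 1 ≥ lam 1 ≥ ⋯`. Partitions are encoded by their
sequences of row lengths, so that this says that `mu / lam` is a horizontal strip. -/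
def Interlace (lam mu : ℕ → ℤ) : Prop := ∀ k, mu (k + 1) ≤ lam k ∧ lam k ≤ mu k

/-- A growth diagram on an `r × r` grid with entries `X i j` in the unit squares and partitions
`G i j` (given by row lengths) at the lattice points. In each unit square, the partition at the far
corner is obtained from the other three and from the entry by the local rule of the
Robinson–Schensted–Knuth correspondence, in its piecewise linear form. -/
structure IsGrowth (r : ℕ) (X : ℕ → ℕ → ℤ) (G : ℕ → ℕ → ℕ → ℤ) : Prop where
  zero_left : ∀ j ≤ r, ∀ k, G 0 j k = 0
  zero_right : ∀ i ≤ r, ∀ k, G i 0 k = 0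
  interlace_left : ∀ i < r, ∀ j ≤ r, Interlace (G i j) (G (i + 1) j)
  interlace_right : ∀ i ≤ r, ∀ j < r, Interlace (G i j) (G i (j + 1))
  rule_zero : ∀ i < r, ∀ j < r, G (i + 1) (j + 1) 0 = max (G (i + 1) j 0) (G i (j + 1) 0) + X i j
  rule_succ : ∀ i < r, ∀ j < r, ∀ k, G (i + 1) (j + 1) (k + 1) =
    max (G (i + 1) j (k + 1)) (G i (j + 1) (k + 1)) + min (G (i + 1) j k) (G i (j + 1) k) - G i j k

/-- A saturated chain of partitions of `0, 1, …, r`, given by row lengths, as a sequence that is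
constant from index `r` on. Only the row lengths `k < r` can be nonzero. -/
structure IsPartitionChain (r : ℕ) (P : ℕ → ℕ → ℤ) : Prop where
  zero : ∀ k, P 0 k = 0
  interlace : ∀ j < r, Interlace (P j) (P (j + 1))
  sum_succ : ∀ j < r, ∑ k ∈ Finset.range r, P (j + 1) k = ∑ k ∈ Finset.range r, P j k + 1
  stable : ∀ j, r ≤ j → P j = P r

namespace IsGrowth

variable {r : ℕ} {X X' : ℕ → ℕ → ℤ} {G G' : ℕ → ℕ → ℕ → ℤ}

theorem transpose (h : IsGrowth r X G) :
    IsGrowth r (fun i j => X j i) (fun i j => G j i) where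
  zero_left := h.zero_right
  zero_right := h.zero_left
  interlace_left i hi j hj := h.interlace_right j hj i hi
  interlace_right i hi j hj := h.interlace_left j hj i hi
  rule_zero i hi j hj := by rw [h.rule_zero j hj i hi, max_comm]
  rule_succ i hi j hj k := by rw [h.rule_succ j hj i hi, max_comm, min_comm]

theorem nonneg (h : IsGrowth r X G) {i j : ℕ} (hi : i ≤ r) (hj : j ≤ r) (k : ℕ) :
    0 ≤ G i j k := by
  induction i with
  | zero => rw [h.zero_left j hj]
  | succ i ih => exact (ih (by omega)).trans (h.interlace_left i hi j hj k).2

theorem eq_zero_of_le (h : IsGrowth r X G) {i j k : ℕ} (hi : i ≤ r) (hj : j ≤ r) (hk : i ≤ k) :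
    G i j k = 0 := by
  induction i generalizing k with
  | zero => exact h.zero_left j hj k
  | succ i ih =>
    obtain ⟨k, rfl⟩ := Nat.exists_eq_add_of_le' hk
    have h1 := (h.interlace_left i hi j hj (k + i)).1
    rw [ih (by omega) (by omega)] at h1
    exact le_antisymm h1 (h.nonneg hi hj _)

/-- The local rule adds up over the rows because `max x y + min x y = x + y`: entries measure the
second difference of the sizes of the partitions. -/
theorem sum_add_sum (h : IsGrowth r X G) {i j : ℕ} (hi : i < r) (hj : j < r) :
    ∑ k ∈ Finset.range r, G (i + 1) (j + 1) k + ∑ k ∈ Finset.range r, G i j k =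
      ∑ k ∈ Finset.range r, G (i + 1) j k + ∑ k ∈ Finset.range r, G i (j + 1) k + X i j := by
  -- The minima in the local rule are shifted by one row, so one more row is summed over.
  have ext : ∀ i' ≤ r, ∀ j' ≤ r,
      ∑ k ∈ Finset.range r, G i' j' k = ∑ k ∈ Finset.range (r + 1), G i' j' k := by
    intro i' hi' j' hj'
    rw [Finset.sum_range_succ, h.eq_zero_of_le hi' hj' hi', add_zero]
  have hmm : ∀ k, max (G (i + 1) j k) (G i (j + 1) k) + min (G (i + 1) j k) (G i (j + 1) k) =
      G (i + 1) j k + G i (j + 1) k := fun k => max_add_min _ _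
  have h1 : ∑ k ∈ Finset.range r, G (i + 1) j k + ∑ k ∈ Finset.range r, G i (j + 1) k =
      ∑ k ∈ Finset.range r, max (G (i + 1) j k) (G i (j + 1) k) +
        ∑ k ∈ Finset.range r, min (G (i + 1) j k) (G i (j + 1) k) := by
    rw [← Finset.sum_add_distrib, ← Finset.sum_add_distrib]
    exact Finset.sum_congr rfl fun k _ => (hmm k).symm
  have h2 : ∑ k ∈ Finset.range r, max (G (i + 1) j k) (G i (j + 1) k) =
      ∑ k ∈ Finset.range (r + 1), max (G (i + 1) j k) (G i (j + 1) k) := by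
    rw [Finset.sum_range_succ, h.eq_zero_of_le hi hj.le hi, h.eq_zero_of_le hi.le hj hi.le]
    simp
  rw [h1, h2, ext (i + 1) hi (j + 1) hj, Finset.sum_range_succ', Finset.sum_range_succ',
    h.rule_zero i hi j hj]
  simp only [h.rule_succ i hi j hj, Finset.sum_sub_distrib, Finset.sum_add_distrib]
  ring

theorem sum_col (h : IsGrowth r X G) {i j : ℕ} (hi : i ≤ r) (hj : j < r) :
    ∑ k ∈ Finset.range r, G i (j + 1) k =
      ∑ k ∈ Finset.range r, G i j k + ∑ a ∈ Finset.range i, X a j := by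
  induction i with
  | zero => simp [h.zero_left j hj.le, h.zero_left (j + 1) hj]
  | succ i ih =>
    have h1 := h.sum_add_sum hi hj
    have h2 := ih (by omega)
    rw [Finset.sum_range_succ (fun a => X a j)]
    linarith

/-- The local rule run forwards: the entries determine the partitions. -/
theorem eq_of_entries (h : IsGrowth r X G) (h' : IsGrowth r X' G')
    (hX : ∀ i < r, ∀ j < r, X i j = X' i j) {i j : ℕ} (hi : i ≤ r) (hj : j ≤ r) :
    G i j = G' i j := by
  induction i generalizing j with
  | zero =>
    funext k
    rw [h.zero_left j hj, h'.zero_left j hj]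
  | succ i ihi =>
    induction j with
    | zero =>
      funext k
      rw [h.zero_right _ hi, h'.zero_right _ hi]
    | succ j ihj =>
      funext k
      cases k with
      | zero =>
        rw [h.rule_zero i hi j hj, h'.rule_zero i hi j hj, ihj (by omega),
          ihi (by omega) (by omega), hX i hi j hj]
      | succ k =>
        rw [h.rule_succ i hi j hj, h'.rule_succ i hi j hj, ihj (by omega),
          ihi (by omega) (by omega), ihi (by omega) (by omega)]

/-- The local rule can be run backwards, so the partitions on the far sides of the grid determine
all others. -/
theorem eq_of_border (h : IsGrowth r X G) (h' : IsGrowth r X' G')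
    (hP : ∀ j ≤ r, G r j = G' r j) (hQ : ∀ i ≤ r, G i r = G' i r) {i j : ℕ} (hi : i ≤ r)
    (hj : j ≤ r) : G i j = G' i j := by
  induction hi using Nat.decreasingInduction generalizing j with
  | self => exact hP j hj
  | of_succ i hi ihi =>
    induction hj using Nat.decreasingInduction with
    | self => exact hQ i hi.le
    | of_succ j hj ihj =>
      funext k
      have h1 := h.rule_succ i hi j hj k
      have h2 := h'.rule_succ i hi j hj k
      have e1 : G (i + 1) (j + 1) = G' (i + 1) (j + 1) := ihi hj
      have e2 : G (i + 1) j = G' (i + 1) j := ihi hj.le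
      have e3 : G i (j + 1) = G' i (j + 1) := ihj
      rw [e1, e2, e3] at h1
      linarith

theorem entry_eq_of_border (h : IsGrowth r X G) (h' : IsGrowth r X' G')
    (hP : ∀ j ≤ r, G r j = G' r j) (hQ : ∀ i ≤ r, G i r = G' i r) {i j : ℕ} (hi : i < r)
    (hj : j < r) : X i j = X' i j := by
  have h1 := h.rule_zero i hi j hj
  have h2 := h'.rule_zero i hi j hj
  have e1 : G (i + 1) (j + 1) = G' (i + 1) (j + 1) := h.eq_of_border h' hP hQ hi hj
  have e2 : G (i + 1) j = G' (i + 1) j := h.eq_of_border h' hP hQ hi hj.le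
  have e3 : G i (j + 1) = G' i (j + 1) := h.eq_of_border h' hP hQ hi.le hj
  rw [e1, e2, e3] at h1
  linarith

theorem eq_of_row_eq_zero (h : IsGrowth r X G) {i j : ℕ} (hi : i < r) (hj : j ≤ r)
    (hX : ∀ b < j, X i b = 0) : G (i + 1) j = G i j := by
  induction j with
  | zero =>
    funext k
    rw [h.zero_right _ hi, h.zero_right _ hi.le]
  | succ j ih =>
    have ih := ih (by omega) fun b hb => hX b (by omega)
    funext k
    cases k with
    | zero =>
      rw [h.rule_zero i hi j hj, ih, hX j (by omega), add_zero]
      exact max_eq_right (h.interlace_right i hi.le j hj 0).2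
    | succ k =>
      rw [h.rule_succ i hi j hj, ih, max_eq_right (h.interlace_right i hi.le j hj (k + 1)).2,
        min_eq_left (h.interlace_right i hi.le j hj k).2]
      ring

theorem eq_of_col_eq_zero (h : IsGrowth r X G) {i j : ℕ} (hi : i ≤ r) (hj : j < r)
    (hX : ∀ a < i, X a j = 0) : G i (j + 1) = G i j :=
  h.transpose.eq_of_row_eq_zero hj hi hX

/-- The far side of the grid carries a saturated chain if every column has entry sum `1`. -/
theorem isPartitionChain (h : IsGrowth r X G)
    (hX : ∀ j < r, ∑ a ∈ Finset.range r, X a j = 1) :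
    IsPartitionChain r fun j => G r (min j r) where
  zero k := by simpa using h.zero_right r le_rfl k
  interlace j hj := by
    simpa [min_eq_left hj.le, min_eq_left (Nat.succ_le_of_lt hj)] using
      h.interlace_right r le_rfl j hj
  sum_succ j hj := by
    simpa [min_eq_left hj.le, min_eq_left (Nat.succ_le_of_lt hj), hX j hj] using
      h.sum_col le_rfl hj
  stable j hj := by simp [min_eq_right hj]

end IsGrowth

/-- The growth diagram with given entries. -/
def growth (X : ℕ → ℕ → ℤ) : ℕ → ℕ → ℕ → ℤ
  | 0, _, _ => 0
  | _ + 1, 0, _ => 0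
  | i + 1, j + 1, 0 => max (growth X (i + 1) j 0) (growth X i (j + 1) 0) + X i j
  | i + 1, j + 1, k + 1 =>
    max (growth X (i + 1) j (k + 1)) (growth X i (j + 1) (k + 1)) +
      min (growth X (i + 1) j k) (growth X i (j + 1) k) - growth X i j k
termination_by i j => i + j

/-- The local rule preserves interlacing. -/
theorem interlace_growth {X : ℕ → ℕ → ℤ} (hX : ∀ i j, 0 ≤ X i j) (i j : ℕ) :
    Interlace (growth X i j) (growth X (i + 1) j) ∧
      Interlace (growth X i j) (growth X i (j + 1)) := by
  have zl : ∀ j k, growth X 0 j k = 0 := fun j k => by rw [growth]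
  have zr : ∀ i k, growth X i 0 k = 0 := fun i k => by cases i <;> rw [growth]
  have step : ∀ i j, Interlace (growth X i j) (growth X (i + 1) j) →
      Interlace (growth X i j) (growth X i (j + 1)) →
      Interlace (growth X i (j + 1)) (growth X (i + 1) (j + 1)) ∧
        Interlace (growth X (i + 1) j) (growth X (i + 1) (j + 1)) := by
    intro i j h1 h2
    have key : ∀ k, max (growth X (i + 1) j k) (growth X i (j + 1) k) ≤
          growth X (i + 1) (j + 1) k ∧
        growth X (i + 1) (j + 1) (k + 1) ≤ min (growth X (i + 1) j k) (growth X i (j + 1) k) := by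
      intro k
      have a := h1 k
      have b := h2 k
      constructor
      · cases k with
        | zero =>
          have := hX i j
          rw [growth.eq_3]
          omega
        | succ k =>
          have c := h1 k
          have d := h2 k
          rw [growth.eq_4]
          omega
      · rw [growth.eq_4]
        omega
    exact ⟨fun k => ⟨by have := (key k).2; omega, by have := (key k).1; omega⟩,
      fun k => ⟨by have := (key k).2; omega, by have := (key k).1; omega⟩⟩
  induction i generalizing j with
  | zero =>
    have hr : ∀ j, Interlace (growth X 0 j) (growth X 0 (j + 1)) := fun j k => by simp [zl]
    refine ⟨?_, hr j⟩
    induction j with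
    | zero => intro k; simp [zr]
    | succ j ih => exact (step 0 j ih (hr j)).1
  | succ i ih =>
    have hr : ∀ j, Interlace (growth X (i + 1) j) (growth X (i + 1) (j + 1)) := fun j =>
      (step i j (ih j).1 (ih j).2).2
    refine ⟨?_, hr j⟩
    induction j with
    | zero => intro k; simp [zr]
    | succ j ihj => exact (step (i + 1) j ihj (hr j)).1

theorem isGrowth_growth {X : ℕ → ℕ → ℤ} (hX : ∀ i j, 0 ≤ X i j) (r : ℕ) :
    IsGrowth r X (growth X) where
  zero_left j _ k := by rw [growth]
  zero_right i _ k := by cases i <;> rw [growth]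
  interlace_left i _ j _ := (interlace_growth hX i j).1
  interlace_right i _ j _ := (interlace_growth hX i j).2
  rule_zero i _ j _ := by rw [growth]
  rule_succ i _ j _ k := by rw [growth]

/-- The partitions of a growth diagram reconstructed from those on the far sides of the grid, with
the coordinates of a lattice point counted from the far corner: `P` and `Q` are the partitions on
the two sides, and the local rule is solved for the near corner of each square. -/
def shrink (P Q : ℕ → ℕ → ℤ) : ℕ → ℕ → ℕ → ℤ
  | 0, b, k => P b k
  | a + 1, 0, k => Q (a + 1) k
  | a + 1, b + 1, k =>
    min (shrink P Q (a + 1) b k) (shrink P Q a (b + 1) k) +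
      max (shrink P Q (a + 1) b (k + 1)) (shrink P Q a (b + 1) (k + 1)) - shrink P Q a b (k + 1)
termination_by a b => a + b

theorem interlace_shrink {P Q : ℕ → ℕ → ℤ} (hPQ : P 0 = Q 0)
    (hP : ∀ b, Interlace (P (b + 1)) (P b)) (hQ : ∀ b, Interlace (Q (b + 1)) (Q b)) (a b : ℕ) :
    Interlace (shrink P Q (a + 1) b) (shrink P Q a b) ∧
      Interlace (shrink P Q a (b + 1)) (shrink P Q a b) := by
  have zl : ∀ b, shrink P Q 0 b = P b := fun b => by funext k; rw [shrink]
  have zr : ∀ a, shrink P Q a 0 = Q a := fun a => by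
    funext k
    cases a with
    | zero => rw [zl, hPQ]
    | succ a => rw [shrink]
  have step : ∀ a b, Interlace (shrink P Q (a + 1) b) (shrink P Q a b) →
      Interlace (shrink P Q a (b + 1)) (shrink P Q a b) →
      Interlace (shrink P Q (a + 1) (b + 1)) (shrink P Q a (b + 1)) ∧
        Interlace (shrink P Q (a + 1) (b + 1)) (shrink P Q (a + 1) b) := by
    intro a b h1 h2
    constructor
    all_goals
      intro k
      have c := h1 k
      have d := h2 k
      have e := h1 (k + 1)
      have f := h2 (k + 1)
      rw [shrink.eq_3]
      omega
  induction a generalizing b with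
  | zero =>
    have hr : ∀ b, Interlace (shrink P Q 0 (b + 1)) (shrink P Q 0 b) := fun b => by
      rw [zl, zl]; exact hP b
    refine ⟨?_, hr b⟩
    induction b with
    | zero => rw [zr, zr]; exact hQ 0
    | succ b ih => exact (step 0 b ih (hr b)).1
  | succ a ih =>
    have hr : ∀ b, Interlace (shrink P Q (a + 1) (b + 1)) (shrink P Q (a + 1) b) := fun b =>
      (step a b (ih b).1 (ih b).2).2
    refine ⟨?_, hr b⟩
    induction b with
    | zero => rw [zr, zr]; exact hQ (a + 1)
    | succ b ihb => exact (step (a + 1) b ihb (hr b)).1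

theorem Interlace.eq_zero {lam mu : ℕ → ℤ} (h : Interlace lam mu) (hmu : ∀ k, mu k = 0) (k : ℕ) :
    lam k = 0 := by
  have h1 := h k
  rw [hmu, hmu] at h1
  omega

/-- Every pair of saturated chains with the same end occurs on the far sides of a growth diagram
with nonnegative entries. -/
theorem exists_isGrowth {r : ℕ} {P Q : ℕ → ℕ → ℤ} (hP : IsPartitionChain r P)
    (hQ : IsPartitionChain r Q) (hPQ : P r = Q r) :
    ∃ X G, IsGrowth r X G ∧ (∀ i < r, ∀ j < r, 0 ≤ X i j) ∧ (∀ j ≤ r, G r j = P j) ∧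
      ∀ i ≤ r, G i r = Q i := by
  have rev : ∀ {P : ℕ → ℕ → ℤ}, IsPartitionChain r P → ∀ b,
      Interlace (P (r - (b + 1))) (P (r - b)) := by
    intro P hP b
    by_cases hb : b < r
    · have := hP.interlace (r - (b + 1)) (by omega)
      rwa [show r - (b + 1) + 1 = r - b by omega] at this
    · rw [show r - (b + 1) = 0 by omega, show r - b = 0 by omega]
      intro k
      rw [hP.zero, hP.zero]
      exact ⟨le_rfl, le_rfl⟩
  -- `H` counts coordinates from the far corner; truncated subtraction continues the chains by the
  -- empty partition, which keeps all interlacing conditions true.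
  let H := shrink (fun b => P (r - b)) (fun a => Q (r - a))
  have hH : ∀ a b, Interlace (H (a + 1) b) (H a b) ∧ Interlace (H a (b + 1)) (H a b) :=
    interlace_shrink hPQ (rev hP) (rev hQ)
  have zl : ∀ b, H 0 b = P (r - b) := fun b => by funext k; simp only [H]; rw [shrink]
  have zr : ∀ a, H a 0 = Q (r - a) := fun a => by
    cases a with
    | zero => rw [zl]; exact hPQ
    | succ a => funext k; simp only [H]; rw [shrink]
  have hzr : ∀ a k, H a r k = 0 := by
    intro a
    induction a with
    | zero => intro k; rw [zl, Nat.sub_self, hP.zero]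
    | succ a ih => exact (hH a r).1.eq_zero ih
  have hzl : ∀ b k, H r b k = 0 := by
    intro b
    induction b with
    | zero => intro k; rw [zr, Nat.sub_self, hQ.zero]
    | succ b ih => exact (hH r b).2.eq_zero ih
  let G : ℕ → ℕ → ℕ → ℤ := fun i j => H (r - i) (r - j)
  have hleft : ∀ i < r, ∀ j, Interlace (G i j) (G (i + 1) j) := by
    intro i hi j
    have := (hH (r - (i + 1)) (r - j)).1
    rwa [show r - (i + 1) + 1 = r - i by omega] at this
  have hright : ∀ i, ∀ j < r, Interlace (G i j) (G i (j + 1)) := by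
    intro i j hj
    have := (hH (r - i) (r - (j + 1))).2
    rwa [show r - (j + 1) + 1 = r - j by omega] at this
  refine ⟨fun i j => G (i + 1) (j + 1) 0 - max (G (i + 1) j 0) (G i (j + 1) 0), G,
    ⟨?_, ?_, fun i hi j _ => hleft i hi j, fun i _ j hj => hright i j hj, ?_, ?_⟩, ?_, ?_, ?_⟩
  · intro j _ k
    simp only [G, Nat.sub_zero, hzl]
  · intro i _ k
    simp only [G, Nat.sub_zero, hzr]
  · intro i _ j _
    omega
  · intro i hi j hj k
    have h1 : G i j k = min (G i (j + 1) k) (G (i + 1) j k) +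
        max (G i (j + 1) (k + 1)) (G (i + 1) j (k + 1)) - G (i + 1) (j + 1) (k + 1) := by
      simp only [G, H]
      rw [show r - i = r - (i + 1) + 1 by omega, show r - j = r - (j + 1) + 1 by omega]
      rw [shrink]
    rw [h1, min_comm, max_comm]
    ring
  · intro i hi j hj
    have h1 := (hleft i hi (j + 1) 0).2
    have h2 := (hright (i + 1) j hj 0).2
    change 0 ≤ G (i + 1) (j + 1) 0 - max (G (i + 1) j 0) (G i (j + 1) 0)
    omega
  · intro j hj
    simp only [G, Nat.sub_self]
    rw [zl, Nat.sub_sub_self hj]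
  · intro i hi
    simp only [G, Nat.sub_self]
    rw [zr, Nat.sub_sub_self hi]

/-! ### The Robinson–Schensted correspondence and Schensted's theorem -/

section Schensted

variable {r : ℕ}

/-- The matrix of a permutation, extended by zero from the `r × r` square. -/
def permMatrix (σ : Equiv.Perm (Fin r)) (i j : ℕ) : ℤ :=
  if ∃ h : i < r, (σ ⟨i, h⟩ : ℕ) = j then 1 else 0

theorem permMatrix_nonneg (σ : Equiv.Perm (Fin r)) (i j : ℕ) : 0 ≤ permMatrix σ i j := by
  unfold permMatrix
  split_ifs <;> simp

theorem permMatrix_coe (σ : Equiv.Perm (Fin r)) (i : Fin r) (j : ℕ) :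
    permMatrix σ i j = if (σ i : ℕ) = j then 1 else 0 := by
  simp [permMatrix]

theorem permMatrix_coe_coe (σ : Equiv.Perm (Fin r)) (i j : Fin r) :
    permMatrix σ i j = if σ i = j then 1 else 0 := by
  simp [permMatrix_coe, Fin.ext_iff]

theorem sum_permMatrix_row (σ : Equiv.Perm (Fin r)) {i : ℕ} (hi : i < r) :
    ∑ j ∈ Finset.range r, permMatrix σ i j = 1 := by
  rw [Finset.sum_range]
  simp_rw [permMatrix_coe_coe σ ⟨i, hi⟩]
  simp

theorem sum_permMatrix_col (σ : Equiv.Perm (Fin r)) {j : ℕ} (hj : j < r) :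
    ∑ i ∈ Finset.range r, permMatrix σ i j = 1 := by
  rw [Finset.sum_range]
  simp_rw [permMatrix_coe_coe σ _ ⟨j, hj⟩, ← Equiv.eq_symm_apply]
  simp

/-- A matrix of nonnegative integers with row and column sums `1` is a permutation matrix. -/
theorem exists_permMatrix_eq {X : ℕ → ℕ → ℤ} (h0 : ∀ i < r, ∀ j < r, 0 ≤ X i j)
    (hrow : ∀ i < r, ∑ j ∈ Finset.range r, X i j = 1)
    (hcol : ∀ j < r, ∑ i ∈ Finset.range r, X i j = 1) :
    ∃ σ : Equiv.Perm (Fin r), ∀ i < r, ∀ j < r, X i j = permMatrix σ i j := by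
  have hrow' : ∀ i : Fin r, ∑ j : Fin r, X i j = 1 := fun i => by
    rw [← hrow i i.2, Finset.sum_range]
  have hcol' : ∀ j : Fin r, ∑ i : Fin r, X i j = 1 := fun j => by
    rw [← hcol j j.2, Finset.sum_range]
  have hpos : ∀ i : Fin r, ∃ j : Fin r, 1 ≤ X i j := by
    intro i
    by_contra! h
    have := Finset.sum_nonpos fun (j : Fin r) (_ : j ∈ Finset.univ) =>
      (Int.lt_add_one_iff.1 (h j) : X i j ≤ 0)
    rw [hrow'] at this
    omega
  choose f hf using hpos
  have hinj : Function.Injective f := by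
    intro a b hab
    by_contra hne
    have h1 := Finset.add_le_sum (f := fun i : Fin r => X i (f a)) (s := Finset.univ)
      (fun i _ => h0 i i.2 _ (f a).2) (Finset.mem_univ a) (Finset.mem_univ b) hne
    rw [hcol'] at h1
    have h2 := hf a
    have h3 := hf b
    rw [← hab] at h3
    omega
  refine ⟨Equiv.ofBijective f (Finite.injective_iff_bijective.1 hinj), fun i hi j hj => ?_⟩
  rw [permMatrix_coe_coe _ ⟨i, hi⟩ ⟨j, hj⟩, Equiv.ofBijective_apply]
  have h2 := hf ⟨i, hi⟩
  have h3 := hrow' ⟨i, hi⟩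
  split_ifs with h
  · have h1 := Finset.single_le_sum (f := fun j : Fin r => X i j) (s := Finset.univ)
      (fun j _ => h0 i hi _ j.2) (Finset.mem_univ ⟨j, hj⟩)
    rw [h] at h2
    dsimp only at h1 h2 h3
    omega
  · have h1 := Finset.add_le_sum (f := fun j : Fin r => X i j) (s := Finset.univ)
      (fun j _ => h0 i hi _ j.2) (Finset.mem_univ (f ⟨i, hi⟩)) (Finset.mem_univ ⟨j, hj⟩) h
    have h4 := h0 i hi j hj
    dsimp only at h1 h2 h3
    omega

/-- The Robinson–Schensted correspondence: the chains of shapes on the far sides of the growth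
diagram of a permutation. -/
def schenstedChains (σ : Equiv.Perm (Fin r)) : (ℕ → ℕ → ℤ) × (ℕ → ℕ → ℤ) :=
  (fun j => growth (permMatrix σ) r (min j r), fun i => growth (permMatrix σ) (min i r) r)

theorem bijOn_schenstedChains :
    Set.BijOn (schenstedChains (r := r)) Set.univ
      {p | IsPartitionChain r p.1 ∧ IsPartitionChain r p.2 ∧ p.1 r = p.2 r} := by
  have hg : ∀ σ : Equiv.Perm (Fin r), IsGrowth r (permMatrix σ) (growth (permMatrix σ)) :=
    fun σ => isGrowth_growth (permMatrix_nonneg σ) r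
  refine ⟨fun σ _ => ⟨?_, ?_, ?_⟩, fun σ _ τ _ h => ?_, fun p hp => ?_⟩
  · exact (hg σ).isPartitionChain fun j hj => sum_permMatrix_col σ hj
  · exact (hg σ).transpose.isPartitionChain fun i hi => sum_permMatrix_row σ hi
  · simp [schenstedChains]
  · have h1 : ∀ j ≤ r, growth (permMatrix σ) r j = growth (permMatrix τ) r j := fun j hj => by
      simpa [schenstedChains, min_eq_left hj] using congrFun (congrArg Prod.fst h) j
    have h2 : ∀ i ≤ r, growth (permMatrix σ) i r = growth (permMatrix τ) i r := fun i hi => by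
      simpa [schenstedChains, min_eq_left hi] using congrFun (congrArg Prod.snd h) i
    ext i
    have h3 := (hg σ).entry_eq_of_border (hg τ) h1 h2 i.2 (σ i).2
    rw [permMatrix_coe, permMatrix_coe, if_pos rfl] at h3
    by_contra hne
    rw [if_neg (Ne.symm hne)] at h3
    exact one_ne_zero h3
  · obtain ⟨hP, hQ, hPQ⟩ := hp
    obtain ⟨X, G, hG, h0, hGP, hGQ⟩ := exists_isGrowth hP hQ hPQ
    obtain ⟨σ, hσ⟩ := exists_permMatrix_eq h0
      (fun i hi => by
        have h1 := hG.transpose.sum_col le_rfl hi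
        simp only [hGQ (i + 1) hi, hGQ i hi.le, hQ.sum_succ i hi] at h1
        linarith)
      (fun j hj => by
        have h1 := hG.sum_col le_rfl hj
        simp only [hGP (j + 1) hj, hGP j hj.le, hP.sum_succ j hj] at h1
        linarith)
    have heq : ∀ i ≤ r, ∀ j ≤ r, growth (permMatrix σ) i j = G i j := fun i hi j hj =>
      ((hG.eq_of_entries (hg σ) hσ hi hj)).symm
    refine ⟨σ, Set.mem_univ _, Prod.ext (funext fun j => ?_) (funext fun i => ?_)⟩
    · change growth (permMatrix σ) r (min j r) = p.1 j
      rw [heq r le_rfl _ (min_le_right _ _), hGP _ (min_le_right _ _)]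
      rcases le_total j r with h | h
      · rw [min_eq_left h]
      · rw [min_eq_right h, hP.stable j h]
    · change growth (permMatrix σ) (min i r) r = p.2 i
      rw [heq _ (min_le_right _ _) r le_rfl, hGQ _ (min_le_right _ _)]
      rcases le_total i r with h | h
      · rw [min_eq_left h]
      · rw [min_eq_right h, hQ.stable i h]

/-- Schensted's theorem, for all upper left rectangles of the permutation matrix: the first row of
the shape is the length of a longest increasing subsequence, because both satisfy the same
recursion. -/
theorem le_growth_permMatrix_zero_iff (σ : Equiv.Perm (Fin r)) {i j : ℕ} (hi : i ≤ r) (hj : j ≤ r)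
    (m : ℕ) :
    (m : ℤ) ≤ growth (permMatrix σ) i j 0 ↔
      ∃ s : Finset (Fin r), m ≤ s.card ∧ StrictMonoOn σ s ∧
        ∀ x ∈ s, (x : ℕ) < i ∧ (σ x : ℕ) < j := by
  have hg : IsGrowth r (permMatrix σ) (growth (permMatrix σ)) :=
    isGrowth_growth (permMatrix_nonneg σ) r
  induction i generalizing j m with
  | zero =>
    rw [hg.zero_left j hj]
    constructor
    · intro hm
      exact ⟨∅, by simp; omega, by simp [StrictMonoOn], by simp⟩
    · rintro ⟨s, hs, -, h⟩
      have : s = ∅ := Finset.eq_empty_of_forall_notMem fun x hx => absurd (h x hx).1 (by omega)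
      simp [this] at hs
      omega
  | succ i ihi =>
  induction j generalizing m with
  | zero =>
    rw [hg.zero_right _ hi]
    constructor
    · intro hm
      exact ⟨∅, by simp; omega, by simp [StrictMonoOn], by simp⟩
    · rintro ⟨s, hs, -, h⟩
      have : s = ∅ := Finset.eq_empty_of_forall_notMem fun x hx => absurd (h x hx).2 (by omega)
      simp [this] at hs
      omega
  | succ j ihj =>
  have hi' : i < r := hi
  have hj' : j < r := hj
  have ih1 := ihj hj'.le
  have ih2 := ihi hi'.le hj
  have ih3 := ihi hi'.le hj'.le
  rw [hg.rule_zero i hi j hj]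
  by_cases hσ : (σ ⟨i, hi'⟩ : ℕ) = j
  · have hX1 : permMatrix σ i j = 1 := if_pos ⟨hi', hσ⟩
    have e1 : growth (permMatrix σ) (i + 1) j = growth (permMatrix σ) i j :=
      hg.eq_of_row_eq_zero hi hj'.le fun b hb => if_neg fun ⟨_, h⟩ => by omega
    have e2 : growth (permMatrix σ) i (j + 1) = growth (permMatrix σ) i j := by
      refine hg.eq_of_col_eq_zero hi'.le hj fun a ha => if_neg fun ⟨ha', h⟩ => ?_
      have := congrArg Fin.val (σ.injective (Fin.ext (h.trans hσ.symm)))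
      simp only at this
      omega
    have hnn := hg.nonneg hi'.le hj'.le 0
    -- The entry `1` lies outside the smaller rectangles, so the three known corners agree, and the
    -- new entry extends every increasing subsequence found so far.
    rw [e1, e2, max_self, hX1]
    constructor
    · intro hm
      obtain ⟨s, hs, hmono, hb⟩ := (ih3 (m - 1)).1 (by omega)
      have his : (⟨i, hi'⟩ : Fin r) ∉ s := fun h => lt_irrefl _ (hb _ h).1
      refine ⟨insert ⟨i, hi'⟩ s, by rw [Finset.card_insert_of_notMem his]; omega, ?_, ?_⟩
      · intro x hx y hy hxy
        simp only [Finset.coe_insert, Set.mem_insert_iff, Finset.mem_coe] at hx hy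
        rcases hx with rfl | hx
        · rcases hy with rfl | hy
          · exact absurd hxy (lt_irrefl _)
          · have := (hb y hy).1
            rw [Fin.lt_def] at hxy
            simp only at hxy
            omega
        · rcases hy with rfl | hy
          · rw [Fin.lt_def, hσ]
            exact (hb x hx).2
          · exact hmono hx hy hxy
      · intro x hx
        rcases Finset.mem_insert.1 hx with rfl | hx
        · exact ⟨Nat.lt_succ_self i, by omega⟩
        · have := hb x hx
          omega
    · rintro ⟨s, hs, hmono, hb⟩
      have h1 : ((m - 1 : ℕ) : ℤ) ≤ growth (permMatrix σ) i j 0 := by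
        refine (ih3 (m - 1)).2 ⟨s.erase ⟨i, hi'⟩, ?_, hmono.mono (by simp), ?_⟩
        · have := Finset.pred_card_le_card_erase (s := s) (a := (⟨i, hi'⟩ : Fin r))
          omega
        · intro x hx
          obtain ⟨hne, hxs⟩ := Finset.mem_erase.1 hx
          have h2 := hb x hxs
          have h3 : (x : ℕ) ≠ i := fun e => hne (Fin.ext e)
          have h4 : (σ x : ℕ) ≠ j := fun e => hne (σ.injective (Fin.ext (e.trans hσ.symm)))
          omega
      omega
  · -- A subsequence cannot use both row `i` and column `j` of the matrix: the entry where they meet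
    -- is zero, and two different entries, each last in one direction, are not increasing.
    have hX0 : permMatrix σ i j = 0 := if_neg fun ⟨_, h⟩ => hσ h
    rw [hX0, add_zero, le_max_iff]
    refine (or_congr (ih1 m) (ih2 m)).trans ?_
    constructor
    · rintro (⟨s, hs, hmono, hb⟩ | ⟨s, hs, hmono, hb⟩)
      · exact ⟨s, hs, hmono, fun x hx => by have := hb x hx; omega⟩
      · exact ⟨s, hs, hmono, fun x hx => by have := hb x hx; omega⟩
    · rintro ⟨s, hs, hmono, hb⟩
      by_cases his : (⟨i, hi'⟩ : Fin r) ∈ s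
      · refine Or.inl ⟨s, hs, hmono, fun x hx => ⟨(hb x hx).1, ?_⟩⟩
        have h1 := (hb _ his).2
        have h2 : σ x ≤ σ ⟨i, hi'⟩ :=
          hmono.monotoneOn hx his (Fin.le_def.2 (Nat.lt_succ_iff.1 (hb x hx).1))
        have h3 := Fin.le_def.1 h2
        omega
      · refine Or.inr ⟨s, hs, hmono, fun x hx => ⟨?_, (hb x hx).2⟩⟩
        have h1 := (hb x hx).1
        have h3 : (x : ℕ) ≠ i := fun e => his (by convert hx; exact e.symm)
        omega

theorem hasIncreasingSubseq_iff (n : ℕ) (σ : Equiv.Perm (Fin r)) :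
    HasIncreasingSubseq n σ ↔ (n : ℤ) < (schenstedChains σ).1 r 0 := by
  have h := le_growth_permMatrix_zero_iff σ le_rfl le_rfl (n + 1)
  have e : (schenstedChains σ).1 r 0 = growth (permMatrix σ) r r 0 := by simp [schenstedChains]
  rw [e, ← Int.add_one_le_iff, ← Nat.cast_succ, h]
  exact ⟨fun ⟨s, hs, hm⟩ => ⟨s, hs, hm, fun x _ => ⟨x.2, (σ x).2⟩⟩,
    fun ⟨s, hs, hm, _⟩ => ⟨s, hs, hm⟩⟩

end Schensted

/-! ### Standard tableaux as saturated chains of partitions -/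

theorem Finset.mem_iff_lt_card_of_isLowerSet {s : Finset ℕ} (hs : IsLowerSet (s : Set ℕ)) {a : ℕ} :
    a ∈ s ↔ a < s.card := by
  constructor
  · intro ha
    have : Finset.range (a + 1) ⊆ s := fun b hb =>
      hs (Nat.lt_succ_iff.1 (Finset.mem_range.1 hb)) ha
    simpa using Finset.card_le_card this
  · intro ha
    by_contra h
    have : s ⊆ Finset.range a := fun b hb => Finset.mem_range.2 <| by
      by_contra! hab
      exact h (hs hab hb)
    have := Finset.card_le_card this
    rw [Finset.card_range] at this
    omega

namespace Nat.Partition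

variable {r : ℕ}

theorem youngDiagram_injective : Function.Injective (youngDiagram (r := r)) := by
  intro μ ν h
  have hpos : ∀ μ : Nat.Partition r, ∀ x ∈ μ.parts.sort (· ≥ ·), 0 < x := fun μ x hx =>
    μ.parts_pos ((Multiset.mem_sort (· ≥ ·)).1 hx)
  have h1 : μ.youngDiagram.rowLens = μ.parts.sort (· ≥ ·) :=
    YoungDiagram.rowLens_ofRowLens_eq_self (hpos μ)
  have h2 : ν.youngDiagram.rowLens = ν.parts.sort (· ≥ ·) :=
    YoungDiagram.rowLens_ofRowLens_eq_self (hpos ν)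
  rw [h] at h1
  refine Nat.Partition.ext ?_
  rw [← Multiset.sort_eq μ.parts (· ≥ ·), ← Multiset.sort_eq ν.parts (· ≥ ·), ← h1, ← h2]

theorem exists_youngDiagram_eq {D : YoungDiagram} (hD : D.card = r) :
    ∃ μ : Nat.Partition r, μ.youngDiagram = D := by
  have hsum : (D.rowLens : Multiset ℕ).sum = r := by
    rw [Multiset.sum_coe, ← hD, YoungDiagram.card,
      Finset.card_eq_sum_card_fiberwise (f := Prod.fst) (t := Finset.range (D.colLen 0))]
    · have h1 : D.rowLens.sum = ∑ i ∈ Finset.range (D.colLen 0), D.rowLen i := rfl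
      rw [h1]
      exact Finset.sum_congr rfl fun i _ => D.rowLen_eq_card
    · rintro ⟨i, j⟩ h
      simp only [Finset.coe_range, Set.mem_Iio]
      rw [← YoungDiagram.mem_iff_lt_colLen]
      exact D.up_left_mem le_rfl (Nat.zero_le j) h
  refine ⟨⟨D.rowLens, fun {i} hi => D.pos_of_mem_rowLens i hi, hsum⟩, ?_⟩
  have hsort : (D.rowLens : Multiset ℕ).sort (· ≥ ·) = D.rowLens :=
    (Multiset.coe_sort _ _).trans (List.mergeSort_eq_self _ D.rowLens_sorted.pairwise)
  refine Eq.trans ?_ YoungDiagram.ofRowLens_to_rowLens_eq_self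
  unfold youngDiagram
  congr 1

theorem lt_sup_parts_iff (μ : Nat.Partition r) (n : ℕ) :
    n < μ.parts.sup ↔ n < μ.youngDiagram.rowLen 0 := by
  rw [← YoungDiagram.mem_iff_lt_rowLen, youngDiagram, YoungDiagram.mem_ofRowLens]
  have hmem : ∀ a, a ∈ μ.parts ↔ a ∈ μ.parts.sort (· ≥ ·) := fun a => by simp
  have hs := (μ.parts.pairwise_sort (· ≥ ·)).sortedGE
  constructor
  · intro h
    by_contra! hc
    refine absurd h (not_lt.2 (Multiset.sup_le.2 fun a ha => ?_))
    obtain ⟨i, hi, rfl⟩ := List.mem_iff_getElem.1 ((hmem a).1 ha)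
    exact (hs.getElem_ge_getElem_of_le (Nat.zero_le i)).trans (hc ((Nat.zero_le i).trans_lt hi))
  · rintro ⟨h0, hn⟩
    exact hn.trans_le (Multiset.le_sup ((hmem _).2 (List.getElem_mem h0)))

end Nat.Partition

section Tableau

variable {r : ℕ} {D : YoungDiagram}

/-- The columns occupied, in row `k`, by entries of the tableau `T` with value less than `j`. -/
def entriesLT (T : D.cells ≃ Fin r) (j k : ℕ) : Finset ℕ :=
  (Finset.range (D.rowLen k)).filter fun l => ∃ h : (k, l) ∈ D.cells, (T ⟨(k, l), h⟩ : ℕ) < j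

/-- The shapes formed by the entries with value less than `j`, given by row lengths. -/
def tableauChain (T : D.cells ≃ Fin r) (j k : ℕ) : ℤ := (entriesLT T j k).card

theorem mem_entriesLT {T : D.cells ≃ Fin r} {j k l : ℕ} :
    l ∈ entriesLT T j k ↔ ∃ h : (k, l) ∈ D.cells, (T ⟨(k, l), h⟩ : ℕ) < j := by
  rw [entriesLT, Finset.mem_filter, Finset.mem_range, ← YoungDiagram.mem_iff_lt_rowLen]
  exact ⟨fun h => h.2, fun h => ⟨h.1, h⟩⟩

theorem tableauChain_self (T : D.cells ≃ Fin r) (k : ℕ) : tableauChain T r k = D.rowLen k := by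
  rw [tableauChain, entriesLT, Finset.filter_true_of_mem, Finset.card_range]
  intro l hl
  exact ⟨YoungDiagram.mem_iff_lt_rowLen.2 (Finset.mem_range.1 hl), Fin.is_lt _⟩

namespace IsStandardTableau

variable {T : D.cells ≃ Fin r}

/-- A standard tableau is recovered from its chain of shapes. -/
theorem lt_iff (hT : IsStandardTableau T) {j k l : ℕ} (h : (k, l) ∈ D.cells) :
    (T ⟨(k, l), h⟩ : ℕ) < j ↔ (l : ℤ) < tableauChain T j k := by
  rw [tableauChain, Nat.cast_lt, ← Finset.mem_iff_lt_card_of_isLowerSet, mem_entriesLT]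
  · exact ⟨fun h1 => ⟨h, h1⟩, fun ⟨_, h1⟩ => h1⟩
  · intro a b hba ha
    obtain ⟨h1, h2⟩ := mem_entriesLT.1 (Finset.mem_coe.1 ha)
    have h3 : (k, b) ∈ D.cells := D.up_left_mem le_rfl hba h1
    refine Finset.mem_coe.2 (mem_entriesLT.2 ⟨h3, lt_of_le_of_lt ?_ h2⟩)
    rcases hba.eq_or_lt with rfl | hba
    · rfl
    · exact (Fin.lt_def.1 (hT.1 ⟨(k, b), h3⟩ ⟨(k, a), h1⟩ rfl hba)).le

theorem fst_le (hT : IsStandardTableau T) {k l : ℕ} (h : (k, l) ∈ D.cells) :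
    k ≤ T ⟨(k, l), h⟩ := by
  induction k with
  | zero => exact Nat.zero_le _
  | succ k ih =>
    have h1 : (k, l) ∈ D.cells := D.up_left_mem (Nat.le_succ k) le_rfl h
    have h2 := Fin.lt_def.1 (hT.2 ⟨(k, l), h1⟩ ⟨(k + 1, l), h⟩ rfl (Nat.lt_succ_self k))
    have := ih h1
    omega

theorem isPartitionChain (hT : IsStandardTableau T) : IsPartitionChain r (tableauChain T) where
  zero k := by
    rw [tableauChain, Nat.cast_eq_zero, Finset.card_eq_zero]
    exact Finset.eq_empty_of_forall_notMem fun l hl => by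
      obtain ⟨_, h⟩ := mem_entriesLT.1 hl
      omega
  interlace j _ k := by
    simp only [tableauChain, Nat.cast_le]
    refine ⟨Finset.card_le_card fun l hl => ?_, Finset.card_le_card fun l hl => ?_⟩
    · obtain ⟨h, h1⟩ := mem_entriesLT.1 hl
      have h2 : (k, l) ∈ D.cells := D.up_left_mem (Nat.le_succ k) le_rfl h
      have h3 := Fin.lt_def.1 (hT.2 ⟨(k, l), h2⟩ ⟨(k + 1, l), h⟩ rfl (Nat.lt_succ_self k))
      exact mem_entriesLT.2 ⟨h2, by omega⟩
    · obtain ⟨h, h1⟩ := mem_entriesLT.1 hl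
      exact mem_entriesLT.2 ⟨h, by omega⟩
  sum_succ j hj := by
    obtain ⟨⟨⟨k₀, l₀⟩, h₀⟩, hT₀⟩ := T.surjective ⟨j, hj⟩
    have hk₀ : k₀ < r := by
      have := hT.fst_le h₀
      rw [hT₀] at this
      exact lt_of_le_of_lt this hj
    have key : ∀ k, tableauChain T (j + 1) k = tableauChain T j k + if k = k₀ then 1 else 0 := by
      intro k
      have hmem : ∀ l, l ∈ entriesLT T (j + 1) k ↔
          l ∈ entriesLT T j k ∨ (k = k₀ ∧ l = l₀) := by
        intro l
        simp only [mem_entriesLT]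
        constructor
        · rintro ⟨h, h1⟩
          rcases Nat.lt_succ_iff_lt_or_eq.1 h1 with h1 | h1
          · exact Or.inl ⟨h, h1⟩
          · right
            have : T ⟨(k, l), h⟩ = T ⟨(k₀, l₀), h₀⟩ := by
              rw [hT₀]
              exact Fin.ext h1
            simpa using T.injective this
        · rintro (⟨h, h1⟩ | ⟨rfl, rfl⟩)
          · exact ⟨h, by omega⟩
          · exact ⟨h₀, by rw [hT₀]; exact Nat.lt_succ_self j⟩
      split_ifs with hk
      · have h1 : entriesLT T (j + 1) k = insert l₀ (entriesLT T j k) := by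
          ext l
          rw [hmem, Finset.mem_insert]
          tauto
        have h2 : l₀ ∉ entriesLT T j k := by
          subst hk
          intro h
          obtain ⟨_, h⟩ := mem_entriesLT.1 h
          rw [hT₀] at h
          exact lt_irrefl _ h
        rw [tableauChain, h1, Finset.card_insert_of_notMem h2, tableauChain]
        push_cast
        rfl
      · have h1 : entriesLT T (j + 1) k = entriesLT T j k := by
          ext l
          rw [hmem]
          tauto
        rw [tableauChain, h1, tableauChain, add_zero]
    simp only [key, Finset.sum_add_distrib, Finset.sum_ite_eq', Finset.mem_range, hk₀, if_true]
  stable j hj := by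
    funext k
    have : entriesLT T j k = entriesLT T r k := by
      ext l
      simp only [mem_entriesLT]
      exact ⟨fun ⟨h, _⟩ => ⟨h, Fin.is_lt _⟩, fun ⟨h, h1⟩ => ⟨h, by omega⟩⟩
    rw [tableauChain, tableauChain, this]

theorem eq_of_tableauChain_eq (hT : IsStandardTableau T) {T' : D.cells ≃ Fin r}
    (hT' : IsStandardTableau T') (h : tableauChain T = tableauChain T') : T = T' := by
  ext ⟨⟨k, l⟩, hkl⟩
  refine eq_of_forall_gt_iff fun j => ?_
  rw [hT.lt_iff hkl, hT'.lt_iff hkl, h]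

end IsStandardTableau

end Tableau

namespace IsPartitionChain

variable {r : ℕ} {P : ℕ → ℕ → ℤ}

theorem le_succ (h : IsPartitionChain r P) (j k : ℕ) : P j k ≤ P (j + 1) k := by
  by_cases hj : j < r
  · exact (h.interlace j hj k).2
  · rw [h.stable j (by omega), h.stable (j + 1) (by omega)]

theorem mono (h : IsPartitionChain r P) {i j : ℕ} (hij : i ≤ j) (k : ℕ) : P i k ≤ P j k :=
  monotone_nat_of_le_succ (f := fun j => P j k) (fun j => h.le_succ j k) hij

theorem nonneg (h : IsPartitionChain r P) (j k : ℕ) : 0 ≤ P j k := by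
  rw [← h.zero k]
  exact h.mono (Nat.zero_le j) k

theorem antitone_row (h : IsPartitionChain r P) (j : ℕ) : Antitone (P j) := by
  refine antitone_nat_of_succ_le fun k => ?_
  have hle : ∀ j ≤ r, P j (k + 1) ≤ P j k := by
    intro j hj
    cases j with
    | zero => rw [h.zero, h.zero]
    | succ j => exact (h.interlace j hj k).1.trans (h.interlace j hj k).2
  rcases le_total j r with hj | hj
  · exact hle j hj
  · rw [h.stable j hj]
    exact hle r le_rfl

theorem eq_zero_of_le (h : IsPartitionChain r P) {j k : ℕ} (hj : j ≤ r) (hk : j ≤ k) :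
    P j k = 0 := by
  induction j generalizing k with
  | zero => exact h.zero k
  | succ j ih =>
    obtain ⟨k, rfl⟩ := Nat.exists_eq_add_of_le' hk
    have h1 := (h.interlace j hj (k + j)).1
    rw [ih (by omega) (by omega)] at h1
    exact le_antisymm h1 (h.nonneg _ _)

theorem le_one (h : IsPartitionChain r P) {j : ℕ} (hj : j < r) (k : ℕ) :
    P (j + 1) k ≤ P j k + 1 := by
  by_cases hk : k < r
  · have h1 := Finset.single_le_sum (f := fun k => P (j + 1) k - P j k)
      (fun k _ => sub_nonneg.2 (h.le_succ j k)) (Finset.mem_range.2 hk)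
    rw [Finset.sum_sub_distrib, h.sum_succ j hj] at h1
    linarith
  · rw [h.eq_zero_of_le hj (by omega)]
    have := h.nonneg j k
    omega

theorem eq_of_lt_of_lt (h : IsPartitionChain r P) {j k k' : ℕ} (hj : j < r)
    (hk : P j k < P (j + 1) k) (hk' : P j k' < P (j + 1) k') : k = k' := by
  by_contra hne
  have hr : ∀ k, P j k < P (j + 1) k → k ∈ Finset.range r := by
    intro k hk
    rw [Finset.mem_range]
    by_contra! hrk
    rw [h.eq_zero_of_le hj (by omega)] at hk
    exact absurd (h.nonneg j k) (not_le.2 hk)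
  have h1 := Finset.add_le_sum (f := fun k => P (j + 1) k - P j k)
    (fun k _ => sub_nonneg.2 (h.le_succ j k)) (hr k hk) (hr k' hk') hne
  rw [Finset.sum_sub_distrib, h.sum_succ j hj] at h1
  linarith

/-- Every chain of shapes comes from a standard tableau: the entry of a box is the step of the
chain that adds it. -/
theorem exists_tableau (h : IsPartitionChain r P) :
    ∃ (μ : Nat.Partition r) (T : μ.youngDiagram.cells ≃ Fin r),
      IsStandardTableau T ∧ tableauChain T = P := by
  let D : YoungDiagram :=
    { cells := (Finset.range r).biUnion fun k => (Finset.range (P r k).toNat).image fun l => (k, l)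
      isLowerSet := by
        rintro ⟨k, l⟩ ⟨k', l'⟩ ⟨hk : k' ≤ k, hl : l' ≤ l⟩ hc
        simp at hc ⊢
        have := h.antitone_row r hk
        omega }
  have hD : ∀ k l, (k, l) ∈ D.cells ↔ (l : ℤ) < P r k := by
    intro k l
    simp only [D, Finset.mem_biUnion, Finset.mem_image, Finset.mem_range, Prod.mk.injEq]
    constructor
    · rintro ⟨_, _, _, h1, rfl, rfl⟩
      omega
    · intro hl
      refine ⟨k, ?_, l, by omega, rfl, rfl⟩
      by_contra! hk
      rw [h.eq_zero_of_le le_rfl hk] at hl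
      omega
  -- A box is added at exactly one step `i`, characterized by the shapes that contain the box.
  have hex : ∀ c : D.cells, ∃ i : Fin r, ∀ j : ℕ, (i : ℕ) < j ↔ (c.1.2 : ℤ) < P j c.1.1 := by
    rintro ⟨⟨k, l⟩, hc⟩
    have hex : ∃ j, (l : ℤ) < P j k := ⟨r, (hD k l).1 hc⟩
    have hpos : 0 < Nat.find hex := by
      rw [Nat.find_pos, h.zero]
      omega
    refine ⟨⟨Nat.find hex - 1, ?_⟩, fun j => ⟨fun hj => ?_, fun hj => ?_⟩⟩
    · have := Nat.find_le (h := hex) ((hD k l).1 hc)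
      omega
    · simp only at hj
      exact (Nat.find_spec hex).trans_le (h.mono (by omega) k)
    · have := Nat.find_le (h := hex) hj
      simp only
      omega
  choose f hf using hex
  have hinj : Function.Injective f := by
    rintro ⟨⟨k, l⟩, hc⟩ ⟨⟨k', l'⟩, hc'⟩ he
    have h1 := hf ⟨(k, l), hc⟩
    have h2 := hf ⟨(k', l'), hc'⟩
    rw [he] at h1
    set i := f ⟨(k', l'), hc'⟩
    dsimp only at h1 h2
    have a1 := (h1 (i + 1)).1 (Nat.lt_succ_self _)
    have a2 := (h2 (i + 1)).1 (Nat.lt_succ_self _)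
    have b1 := mt (h1 i).2 (lt_irrefl _)
    have b2 := mt (h2 i).2 (lt_irrefl _)
    obtain rfl : k = k' := h.eq_of_lt_of_lt i.2 (by omega) (by omega)
    have c1 := h.le_one i.2 k
    obtain rfl : l = l' := by omega
    rfl
  have hsurj : Function.Surjective f := by
    intro i
    obtain ⟨k, -, hk⟩ := Finset.exists_lt_of_sum_lt
      (f := P i) (g := P (i + 1)) (s := Finset.range r) (by rw [h.sum_succ i i.2]; omega)
    have hnn := h.nonneg i k
    have hc : (k, (P i k).toNat) ∈ D.cells := by
      rw [hD]
      have := h.mono (show (i : ℕ) + 1 ≤ r from i.2) k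
      omega
    refine ⟨⟨_, hc⟩, Fin.ext ?_⟩
    have h1 := hf ⟨_, hc⟩
    have h2 := (h1 (i + 1)).2 (by dsimp only; omega)
    have h3 := mt (h1 i).1 (by dsimp only; omega)
    omega
  let T := Equiv.ofBijective f ⟨hinj, hsurj⟩
  have hTf : ∀ c, T c = f c := fun c => rfl
  have hT : IsStandardTableau T := by
    refine ⟨fun c d hrow hcol => ?_, fun c d hcol hrow => ?_⟩
    · refine lt_of_le_of_ne ?_ fun e => hcol.ne (congrArg (fun c => c.1.2) (T.injective e))
      rw [Fin.le_def, ← Nat.lt_succ_iff, hTf, hTf, hf]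
      have := (hf d (f d + 1)).1 (Nat.lt_succ_self _)
      rw [hrow]
      simp only [Nat.succ_eq_add_one]
      omega
    · rw [Fin.lt_def, hTf, hTf, hf]
      have h1 := (hf d (f d + 1)).1 (Nat.lt_succ_self _)
      have h2 := (h.interlace (f d) (f d).2 c.1.1).1
      have h3 := h.antitone_row (f d + 1) (Nat.succ_le_of_lt hrow)
      rw [Nat.succ_eq_add_one] at h3
      rw [hcol]
      omega
  have hchain : tableauChain T = P := by
    funext j k
    have hent : entriesLT T j k = Finset.range (P j k).toNat := by
      ext l
      rw [mem_entriesLT, Finset.mem_range]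
      constructor
      · rintro ⟨hc, h1⟩
        have := (hf ⟨(k, l), hc⟩ j).1 h1
        dsimp only at this
        omega
      · intro hl
        have hlt : (l : ℤ) < P j k := by omega
        have hle : P j k ≤ P r k := by
          rcases le_total j r with hj | hj
          · exact h.mono hj k
          · rw [h.stable j hj]
        have hc : (k, l) ∈ D.cells := (hD k l).2 (by omega)
        exact ⟨hc, (hf ⟨(k, l), hc⟩ j).2 hlt⟩
    have := h.nonneg j k
    rw [tableauChain, hent, Finset.card_range]
    omega
  have hcard : D.card = r := by simpa [YoungDiagram.card] using Fintype.card_congr T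
  obtain ⟨μ, hμ⟩ := Nat.Partition.exists_youngDiagram_eq hcard
  clear_value D
  subst hμ
  exact ⟨μ, T, hT, hchain⟩

end IsPartitionChain

/-! ### Counting permutations by pairs of tableaux -/

/-- Pairs of standard tableaux of the same shape, the first row of which has more than `n` boxes. -/
abbrev TableauPair (n r : ℕ) : Type :=
  Σ μ : {μ // μ ∈ partitionsWithLargeFirstPart n r},
    {T : μ.1.youngDiagram.cells ≃ Fin r // IsStandardTableau T} ×
      {T : μ.1.youngDiagram.cells ≃ Fin r // IsStandardTableau T}

/-- The chains of shapes of the two tableaux of a pair. -/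
def TableauPair.chains {n r : ℕ} (p : TableauPair n r) : (ℕ → ℕ → ℤ) × (ℕ → ℕ → ℤ) :=
  (tableauChain p.2.1.1, tableauChain p.2.2.1)

theorem TableauPair.bijOn_chains (n r : ℕ) :
    Set.BijOn (TableauPair.chains (n := n) (r := r)) Set.univ
      {p | (IsPartitionChain r p.1 ∧ IsPartitionChain r p.2 ∧ p.1 r = p.2 r) ∧
        (n : ℤ) < p.1 r 0} := by
  -- The shape is the last partition of either chain.
  have hshape : ∀ {μ ν : Nat.Partition r} (T : μ.youngDiagram.cells ≃ Fin r)
      (T' : ν.youngDiagram.cells ≃ Fin r), tableauChain T r = tableauChain T' r → μ = ν := by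
    intro μ ν T T' h
    refine Nat.Partition.youngDiagram_injective (YoungDiagram.ext (Finset.ext ?_))
    rintro ⟨k, l⟩
    have hk := congrFun h k
    rw [tableauChain_self, tableauChain_self, Nat.cast_inj] at hk
    rw [YoungDiagram.mem_cells, YoungDiagram.mem_cells, YoungDiagram.mem_iff_lt_rowLen,
      YoungDiagram.mem_iff_lt_rowLen, hk]
  have hlarge : ∀ {μ : Nat.Partition r} (T : μ.youngDiagram.cells ≃ Fin r),
      μ ∈ partitionsWithLargeFirstPart n r ↔ (n : ℤ) < tableauChain T r 0 := by
    intro μ T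
    rw [tableauChain_self, Nat.cast_lt, ← Nat.Partition.lt_sup_parts_iff,
      partitionsWithLargeFirstPart, Finset.mem_filter]
    exact and_iff_right (Finset.mem_univ _)
  refine ⟨?_, ?_, ?_⟩
  · rintro ⟨μ, T, T'⟩ -
    refine ⟨⟨T.2.isPartitionChain, T'.2.isPartitionChain, ?_⟩, (hlarge T.1).1 μ.2⟩
    funext k
    exact (tableauChain_self T.1 k).trans (tableauChain_self T'.1 k).symm
  · rintro ⟨⟨μ, hμ⟩, T, T'⟩ - ⟨⟨ν, hν⟩, U, U'⟩ - h
    obtain ⟨h1, h2⟩ := Prod.mk.inj h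
    dsimp only at h1 h2
    obtain rfl : μ = ν := hshape T.1 U.1 (congrFun h1 r)
    obtain rfl : T = U := Subtype.ext (T.2.eq_of_tableauChain_eq U.2 h1)
    obtain rfl : T' = U' := Subtype.ext (T'.2.eq_of_tableauChain_eq U'.2 h2)
    rfl
  · rintro ⟨P, Q⟩ ⟨⟨hP, hQ, hPQ⟩, hn⟩
    obtain ⟨μ, T, hT, rfl⟩ := hP.exists_tableau
    obtain ⟨ν, T', hT', rfl⟩ := hQ.exists_tableau
    obtain rfl : μ = ν := hshape T T' hPQ
    exact ⟨⟨⟨μ, (hlarge T).2 hn⟩, ⟨T, hT⟩, ⟨T', hT'⟩⟩, Set.mem_univ _, rfl⟩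

/-- By the Robinson–Schensted correspondence and Schensted's theorem, the permutations with an
increasing subsequence of more than `n` terms are counted by pairs of tableaux. -/
theorem card_hasIncreasingSubseq (n r : ℕ) :
    Nat.card {σ : Equiv.Perm (Fin r) // HasIncreasingSubseq n σ} =
      ∑ μ ∈ partitionsWithLargeFirstPart n r, numStandardTableaux μ ^ 2 := by
  have hS : Set.BijOn (schenstedChains (r := r)) {σ | HasIncreasingSubseq n σ}
      {p | (IsPartitionChain r p.1 ∧ IsPartitionChain r p.2 ∧ p.1 r = p.2 r) ∧
        (n : ℤ) < p.1 r 0} := by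
    refine ⟨fun σ hσ => ⟨bijOn_schenstedChains.mapsTo (Set.mem_univ σ),
      (hasIncreasingSubseq_iff n σ).1 hσ⟩,
      bijOn_schenstedChains.injOn.mono (Set.subset_univ _), fun p hp => ?_⟩
    obtain ⟨σ, -, rfl⟩ := bijOn_schenstedChains.surjOn hp.1
    exact ⟨σ, (hasIncreasingSubseq_iff n σ).2 hp.2, rfl⟩
  have e1 := Nat.card_congr (hS.equiv _)
  have e2 := Nat.card_congr ((TableauPair.bijOn_chains n r).equiv _)
  rw [Nat.card_coe_set_eq, Set.ncard_univ] at e2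
  calc Nat.card {σ : Equiv.Perm (Fin r) // HasIncreasingSubseq n σ}
      = Nat.card (TableauPair n r) := e1.trans e2.symm
    _ = ∑ μ ∈ partitionsWithLargeFirstPart n r, numStandardTableaux μ ^ 2 := by
        rw [Nat.card_sigma, Finset.sum_coe_sort (partitionsWithLargeFirstPart n r)
          fun μ => Nat.card ({T : μ.youngDiagram.cells ≃ Fin r // IsStandardTableau T} ×
            {T : μ.youngDiagram.cells ≃ Fin r // IsStandardTableau T})]
        refine Finset.sum_congr rfl fun μ _ => ?_
        rw [Nat.card_prod, numStandardTableaux, sq]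

theorem card_not_hasIncreasingSubseq (n r : ℕ) :
    (Nat.card {σ : Equiv.Perm (Fin r) // ¬ HasIncreasingSubseq n σ} : ℤ) =
      (Nat.factorial r : ℤ) -
        ∑ μ ∈ partitionsWithLargeFirstPart n r, (numStandardTableaux μ : ℤ) ^ 2 := by
  classical
  have h := Fintype.card_subtype_compl fun σ : Equiv.Perm (Fin r) => HasIncreasingSubseq n σ
  have hle := Fintype.card_subtype_le fun σ : Equiv.Perm (Fin r) => HasIncreasingSubseq n σ
  have hc := card_hasIncreasingSubseq n r
  rw [Nat.card_eq_fintype_card] at hc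
  rw [Nat.card_eq_fintype_card, h, Nat.cast_sub hle, hc, Fintype.card_perm, Fintype.card_fin]
  push_cast
  rfl

theorem finrank_groupAlgebraRep_range {K : Type*} [CommRing K] [Nontrivial K] {V : Type*}
    [AddCommGroup V] [Module K V] {n r : ℕ} (b : Module.Basis (Fin n) K V) :
    (Module.finrank K (groupAlgebraRep K V r).range : ℤ) =
      (Nat.factorial r : ℤ) -
        ∑ μ ∈ partitionsWithLargeFirstPart n r, (numStandardTableaux μ : ℤ) ^ 2 := by
  rw [Module.finrank_eq_nat_card_basis (groupAlgebraRepRangeBasis b), card_not_hasIncreasingSubseq]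

theorem mainTheorem3 (n r : ℕ) :
    (∀ (K : Type*) [CommRing K] [IsDomain K]
      (V : Type*) [AddCommGroup V] [Module K V] [Module.Free K V] [Module.Finite K V],
      Module.finrank K V = n →
        Module.Free K (groupAlgebraRep K V r).range ∧
        Module.Finite K (groupAlgebraRep K V r).range ∧
        (Module.finrank K (groupAlgebraRep K V r).range : ℤ) =
          (Nat.factorial r : ℤ) -
            ∑ μ ∈ partitionsWithLargeFirstPart n r, (numStandardTableaux μ : ℤ) ^ 2) ∧
    (∀ (K : Type*) [CommRing K] [IsDomain K]
      (V : Type*) [AddCommGroup V] [Module K V] [Module.Free K V] [Module.Finite K V]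
      (K' : Type*) [CommRing K'] [IsDomain K']
      (V' : Type*) [AddCommGroup V'] [Module K' V'] [Module.Free K' V'] [Module.Finite K' V'],
      Module.finrank K V = n → Module.finrank K' V' = n →
        Module.finrank K (groupAlgebraRep K V r).range =
          Module.finrank K' (groupAlgebraRep K' V' r).range) := by
  refine ⟨?_, ?_⟩
  · intro K _ _ V _ _ _ _ hn
    let b := Module.finBasisOfFinrankEq K V hn
    exact ⟨Module.Free.of_basis (groupAlgebraRepRangeBasis b),
      Module.Finite.of_basis (groupAlgebraRepRangeBasis b), finrank_groupAlgebraRep_range b⟩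
  · intro K _ _ V _ _ _ _ K' _ _ V' _ _ _ _ hn hn'
    have h := finrank_groupAlgebraRep_range (r := r) (Module.finBasisOfFinrankEq K V hn)
    have h' := finrank_groupAlgebraRep_range (r := r) (Module.finBasisOfFinrankEq K' V' hn')
    exact_mod_cast h.trans h'.symm
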